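/- Let $G$ be a finite group and let $k$ be a commutative Noetherian ring. Let $\mathrm{OI}_G$ be the category whose objects are the nonnegative integers and whose morphisms $r \to s$ are the pairs $(f,g)$ consisting of a strictly increasing map $f \colon \{1,\dots,r\} \to \{1,\dots,s\}$ and an arbitrary map $g \colon \{1,\dots,r\} \to G$, with composition $(f_2,g_2)\circ(f_1,g_1) = (f_2\circ f_1,\, g_3)$, $g_3(i) = g_2(f_1(i))\cdot g_1(i)$. An $\mathrm{OI}_G$-module over $k$ is a functor $V \colon s \mapsto V_s$ from $\mathrm{OI}_G$ to the category of $k$-modules (equivalently, a $k$-linear functor on the $k$-linearization of $\mathrm{OI}_G$); it is finitely generated if it contains a finite set of elements such that the only $\mathrm{OI}_G$-submodule of $V$ containing this set is $V$ itself. Let $\mathfrak{m}V \subseteq V$ be the submodule such that $(\mathfrak{m}V)_s$ is spanned by the images of the maps $V_r \to V_s$ induced by all morphisms $r \to s$ with $r < s$. Put $H_0(V) = V/\mathfrak{m}V$, and for $i \geq 0$ let $H_i$ be the $i$-th left derived functor of $H_0$ on the category of $\mathrm{OI}_G$-modules. Define $$\mathrm{hd}_i(V) = \sup\{\, s \geq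 0 \mid H_i(V)_s \neq 0 \,\} \in \{-1,0,1,\dots\}\cup\{\infty\},$$ with $\mathrm{hd}_i(V) = -1$ if this set is empty, and the Castelnuovo--Mumford regularity $$\mathrm{reg}(V) = \sup\{\, \mathrm{hd}_i(V) - i \mid i \geq 0 \,\}.$$ If $V$ is a finitely generated $\mathrm{OI}_G$-module over $k$, then $\mathrm{reg}(V) < \infty$. -/

import Mathlib

open CategoryTheory CategoryTheory.Limits

universe u v w

/-- The objects of the category `OI_G`: the nonnegative integers, where `⟨s⟩` stands for the
ordered set with `s` elements, here `Fin s`. -/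
@[ext]
structure OI (G : Type v) : Type where
  /-- the underlying nonnegative integer -/
  size : ℕ

namespace OI

variable {G : Type v}

/-- A morphism `r ⟶ s` of `OI_G`: a strictly increasing map `f` together with an arbitrary
`G`-valued map `g` on its source. -/
@[ext]
structure Hom (r s : OI G) : Type v where
  /-- the strictly increasing map -/
  f : Fin r.size ↪o Fin s.size
  /-- the labels in `G` -/
  g : Fin r.size → G

instance [Finite G] (r s : OI G) : Finite (Hom r s) :=
  Finite.of_injective (fun a : Hom r s => ((a.f : Fin r.size → Fin s.size), a.g)) (by
    intro a b h
    simp only [Prod.mk.injEq] at h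
    exact Hom.ext (DFunLike.coe_injective h.1) h.2)

instance [Group G] : Category.{v} (OI G) where
  Hom r s := Hom r s
  id r := ⟨RelEmbedding.refl _, fun _ => 1⟩
  comp a b := ⟨a.f.trans b.f, fun i => b.g (a.f i) * a.g i⟩
  id_comp a := by
    apply Hom.ext
    · ext i; rfl
    · funext i; exact mul_one _
  comp_id a := by
    apply Hom.ext
    · ext i; rfl
    · funext i; exact one_mul _
  assoc a b c := by
    apply Hom.ext
    · ext i; rfl
    · funext i; exact (mul_assoc _ _ _).symm

instance [Group G] [Finite G] (r s : OI G) : Finite (r ⟶ s) :=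
  inferInstanceAs (Finite (Hom r s))

theorem size_le_of_hom [Group G] {r s : OI G} (a : r ⟶ s) : r.size ≤ s.size := by
  simpa using Fintype.card_le_of_embedding (Hom.f a).toEmbedding

end OI

/-- `OI_G`-modules over `k`: functors from `OI_G` to `k`-modules (equivalently, `k`-linear functors
from the `k`-linearization of `OI_G` to `k`-modules). -/
abbrev OIModule (k : Type u) [CommRing k] (G : Type v) [Group G] :=
  OI G ⥤ ModuleCat.{w} k

namespace OIModule

variable {k : Type u} [CommRing k] {G : Type v} [Group G]

/-- A submodule of an `OI_G`-module `V`: a family of `k`-submodules `N_s ⊆ V_s` stable under all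
morphisms of `OI_G`. -/
structure Sub (V : OIModule.{u, v, w} k G) where
  /-- the value on the object `s` -/
  val : ∀ s : OI G, Submodule k (V.obj s)
  map_mem : ∀ {r s : OI G} (a : r ⟶ s) (x : V.obj r), x ∈ val r → V.map a x ∈ val s

/-- `V` is finitely generated: it contains a finite set of elements such that the only submodule
of `V` containing this set is `V` itself. -/
def IsFinitelyGenerated (V : OIModule.{u, v, w} k G) : Prop :=
  ∃ T : Set (Σ s : OI G, V.obj s), T.Finite ∧
    ∀ N : Sub V, (∀ x ∈ T, x.2 ∈ N.val x.1) → ∀ s : OI G, N.val s = ⊤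

/-- `(𝔪V)_s ⊆ V_s`, where `𝔪` is the two-sided ideal `⨁_{r < s} C(r, s)`: the `k`-submodule
spanned by the images of all morphisms `r ⟶ s` with `r < s`. -/
def decomposable (V : OIModule.{u, v, w} k G) (s : OI G) : Submodule k (V.obj s) :=
  ⨆ (r : OI G) (_ : r.size < s.size) (a : r ⟶ s), LinearMap.range (V.map a).hom

theorem decomposable_le_comap_map (V : OIModule.{u, v, w} k G) {s t : OI G} (b : s ⟶ t) :
    decomposable V s ≤ (decomposable V t).comap (V.map b).hom := by
  refine iSup_le fun r => iSup_le fun hr => iSup_le fun a => ?_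
  rintro _ ⟨x, rfl⟩
  refine Submodule.mem_iSup_of_mem r (Submodule.mem_iSup_of_mem
    (hr.trans_le (OI.size_le_of_hom b)) (Submodule.mem_iSup_of_mem (a ≫ b) ⟨x, ?_⟩))
  simp

theorem decomposable_le_comap_app {V W : OIModule.{u, v, w} k G} (φ : V ⟶ W) (s : OI G) :
    decomposable V s ≤ (decomposable W s).comap (φ.app s).hom := by
  refine iSup_le fun r => iSup_le fun hr => iSup_le fun a => ?_
  rintro _ ⟨x, rfl⟩
  refine Submodule.mem_iSup_of_mem r (Submodule.mem_iSup_of_mem hr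
    (Submodule.mem_iSup_of_mem a ⟨φ.app r x, ?_⟩))
  exact (NatTrans.naturality_apply φ a x).symm

variable (k G)

/-- The functor `H₀ : V ↦ V / 𝔪V` from `OI_G`-modules to `OI_G`-modules. -/
def H₀ : OIModule.{u, v, w} k G ⥤ OIModule.{u, v, w} k G where
  obj V :=
    { obj := fun s => ModuleCat.of k (V.obj s ⧸ decomposable V s)
      map := fun {s t} b => ModuleCat.ofHom
        (Submodule.mapQ (decomposable V s) (decomposable V t) (V.map b).hom
          (decomposable_le_comap_map V b))
      map_id := fun s => by
        apply ModuleCat.hom_ext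
        apply Submodule.linearMap_qext
        ext x
        simp
      map_comp := fun a b => by
        apply ModuleCat.hom_ext
        apply Submodule.linearMap_qext
        ext x
        simp }
  map {V W} φ :=
    { app := fun s => ModuleCat.ofHom
        (Submodule.mapQ (decomposable V s) (decomposable W s) (φ.app s).hom
          (decomposable_le_comap_app φ s))
      naturality := fun s t b => by
        apply ModuleCat.hom_ext
        apply Submodule.linearMap_qext
        ext x
        simp [NatTrans.naturality_apply] }
  map_id V := by
    ext s : 2
    apply ModuleCat.hom_ext
    apply Submodule.linearMap_qext
    ext x
    simp
  map_comp φ ψ := by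
    ext s : 2
    apply ModuleCat.hom_ext
    apply Submodule.linearMap_qext
    ext x
    simp

instance : (H₀.{u, v, w} k G).Additive where
  map_add {V W φ ψ} := by
    ext s : 2
    apply ModuleCat.hom_ext
    apply Submodule.linearMap_qext
    rfl

/-- The category of `OI_G`-modules has enough projectives (`G` finite). -/
instance [Finite G] [Small.{w} k] : EnoughProjectives (OIModule.{u, v, w} k G) where
  presentation V := by
    let P : OI G → OIModule.{u, v, w} k G := fun s =>
      (evaluationLeftAdjoint (ModuleCat.{w} k) s).obj (Projective.over (V.obj s))
    let adj := fun s : OI G => evaluationAdjunctionRight (C := OI G) (ModuleCat.{w} k) s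
    let q : ∀ s, P s ⟶ V := fun s => ((adj s).homEquiv _ _).symm (Projective.π (V.obj s))
    have hP : ∀ s, Projective (P s) := fun s =>
      (adj s).map_projective _ inferInstance
    have : HasCoproduct P := inferInstance
    have hS : Projective (∐ P) := ⟨fun f e _ =>
      ⟨Sigma.desc fun b => (hP b).factors (Sigma.ι P b ≫ f) e |>.choose, by
        refine Sigma.hom_ext _ _ fun b => ?_
        simpa using ((hP b).factors (Sigma.ι P b ≫ f) e).choose_spec⟩⟩
    have hepi : Epi (Sigma.desc q) := by
      have : ∀ s, Epi ((Sigma.desc q).app s) := fun s => by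
        have h : (adj s).homEquiv _ _ (Sigma.ι P s ≫ Sigma.desc q) = Projective.π (V.obj s) := by
          simp [q]
        rw [Adjunction.homEquiv_unit, Functor.map_comp, ← Category.assoc] at h
        exact epi_of_epi_fac h
      exact NatTrans.epi_of_epi_app _
    exact ⟨{ p := ∐ P, projective := hS, f := Sigma.desc q, epi := hepi }⟩

variable {k G}

/-- The `i`-th homology `H_i(V) = Tor_i(C/𝔪, V)`: the value at `V` of the `i`-th left derived
functor of `H₀`. -/
noncomputable def homology [Finite G] [Small.{w} k] (V : OIModule.{u, v, w} k G) (i : ℕ) :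
    OIModule.{u, v, w} k G :=
  ((H₀.{u, v, w} k G).leftDerived i).obj V

/-- The `i`-th homological degree `hd_i(V) ∈ {-1, 0, 1, …, ∞}`: the supremum of all `s ≥ 0` with
`H_i(V)_s ≠ 0`, and `-1` if there is no such `s`. -/
noncomputable def hd [Finite G] [Small.{w} k] (V : OIModule.{u, v, w} k G) (i : ℕ) : EReal :=
  max (-1) (⨆ s ∈ {s : ℕ | Nontrivial ((homology V i).obj ⟨s⟩)}, ((s : ℝ) : EReal))

/-- The Castelnuovo–Mumford regularity `reg(V) = sup {hd_i(V) - i | i ≥ 0}`. -/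
noncomputable def reg [Finite G] [Small.{w} k] (V : OIModule.{u, v, w} k G) : EReal :=
  ⨆ i : ℕ, (hd V i - ((i : ℝ) : EReal))

end OIModule

/-! Adding a new least element defines a shift functor Σ with a natural map V → ΣV; let DV be its
cokernel. A free module P embeds into ΣP, and DP is again free with generators one degree lower,
finitely many if those of P were (`FreeBasis.exists_deriv`). Moreover H_0(DV)_s = H_0(V)_{s+1}
(`derivProj_mem_decomposable_iff`). Hence, when X embeds into ΣX, vanishing in degree s for DX gives
vanishing in degree s + 1 for X (`ExtVanish.of_deriv`).

Through a presentation it suffices to bound submodules X of a finitely generated free P. The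
argument is an induction on the generator degrees of P and, for fixed P, a Noetherian induction on
X. Let X' ⊇ X be the preimage of ΣX under P → ΣP, and Y the image of ΣX in DP, so that 0 → X' → ΣX →
Y → 0 is exact. Y is bounded by the induction on P. If X' = X, then DX ≅ Y and X is bounded.
Otherwise X' is bounded by Noetherian induction, hence so is ΣX, and 0 → X → ΣX → DX → 0 bounds
H_{i+1}(X)_{s+1} in terms of H_{i+1}(ΣX)_s and H_i(X)_s: an induction on i that starts from the
generation degree of X. That P is Noetherian is proved with the same X' and Y, in the style of the
Hilbert basis theorem.

Homology is treated dually. The functor V ↦ H_0(V)_s has a right adjoint `coind s`, and H_n(V)_s = 0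
follows from Ext^n(V, coind s I) = 0 for all I, so the long exact sequences of Ext carry the
argument. -/

namespace OI

/-! ### The shift of `OI_G` and its morphisms -/

variable {G : Type v}

/-- Extension of an order embedding by a new least element mapped to the least element. -/
def consEmbedding {m n : ℕ} (f : Fin m ↪o Fin n) : Fin (m + 1) ↪o Fin (n + 1) :=
  OrderEmbedding.ofStrictMono (Fin.cases 0 fun i => (f i).succ) (by
    intro i j h
    induction i using Fin.cases with
    | zero =>
      induction j using Fin.cases with
      | zero => exact absurd h (lt_irrefl _)
      | succ j => exact Fin.succ_pos _
    | succ i =>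
      induction j using Fin.cases with
      | zero => exact absurd h (Fin.not_lt_zero _)
      | succ j => exact Fin.succ_lt_succ_iff.2 (f.strictMono (Fin.succ_lt_succ_iff.1 h)))

variable [Group G]

@[simp] theorem comp_g {r s t : OI G} (a : r ⟶ s) (b : s ⟶ t) (i : Fin r.size) :
    Hom.g (a ≫ b) i = Hom.g b (Hom.f a i) * Hom.g a i := rfl

theorem hom_ext {r s : OI G} {a b : r ⟶ s} (hf : ∀ i, Hom.f a i = Hom.f b i)
    (hg : ∀ i, Hom.g a i = Hom.g b i) : a = b :=
  Hom.ext (RelEmbedding.ext hf) (funext hg)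

/-- The morphism `r + 1 ⟶ s + 1` which sends the new least element to the new least element with
label `g` and which is `a` elsewhere. -/
def consHom (g : G) {r s : OI G} (a : r ⟶ s) :
    (⟨r.size + 1⟩ : OI G) ⟶ (⟨s.size + 1⟩ : OI G) :=
  (⟨consEmbedding (Hom.f a), Fin.cases (motive := fun _ => G) g (Hom.g a)⟩ : Hom _ _)

theorem hom_ext_cons {n : ℕ} {s : OI G} {a b : (⟨n + 1⟩ : OI G) ⟶ s}
    (hf0 : Hom.f a (0 : Fin (n + 1)) = Hom.f b (0 : Fin (n + 1)))
    (hg0 : Hom.g a (0 : Fin (n + 1)) = Hom.g b (0 : Fin (n + 1)))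
    (hf : ∀ i : Fin n, Hom.f a i.succ = Hom.f b i.succ)
    (hg : ∀ i : Fin n, Hom.g a i.succ = Hom.g b i.succ) : a = b :=
  hom_ext
    (fun i => Fin.cases (motive := fun i : Fin (n + 1) => Hom.f a i = Hom.f b i) hf0 hf i)
    (fun i => Fin.cases (motive := fun i : Fin (n + 1) => Hom.g a i = Hom.g b i) hg0 hg i)

theorem consHom_comp (g h : G) {r s t : OI G} (a : r ⟶ s) (b : s ⟶ t) :
    consHom g a ≫ consHom h b = consHom (h * g) (a ≫ b) :=
  hom_ext_cons rfl rfl (fun _ => rfl) (fun _ => rfl)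

/-- The shift endofunctor of `OI_G`, which adds a new least element. -/
def shift : OI G ⥤ OI G where
  obj s := ⟨s.size + 1⟩
  map a := consHom 1 a
  map_id r := by
    exact hom_ext_cons rfl rfl (fun _ => rfl) (fun _ => rfl)
  map_comp a b := by
    refine (consHom_comp 1 1 a b).symm ▸ ?_
    rw [one_mul]

/-- The morphism `s ⟶ s + 1` which misses the least element. -/
def front (s : OI G) : s ⟶ shift.obj s :=
  (⟨Fin.succOrderEmb s.size, fun _ => 1⟩ : Hom _ _)

@[simp] theorem front_g (s : OI G) (i : Fin s.size) : Hom.g (front s) i = 1 := rfl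

theorem front_naturality {r s : OI G} (a : r ⟶ s) :
    a ≫ front s = front r ≫ shift.map a :=
  hom_ext (fun _ => rfl) (fun _ => (one_mul _).trans (mul_one _).symm)

theorem comp_front_injective {r s : OI G} {a b : r ⟶ s} (h : a ≫ front s = b ≫ front s) :
    a = b := by
  refine hom_ext (fun i => ?_) (fun i => ?_)
  · exact Fin.succ_injective _ (congrArg (fun c : r ⟶ shift.obj s => Hom.f c i) h)
  · have := congrArg (fun c : r ⟶ shift.obj s => Hom.g c i) h
    simpa using this

theorem consHom_injective {r s : OI G} {g h : G} {a b : r ⟶ s}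
    (e : consHom g a = consHom h b) : g = h ∧ a = b := by
  refine ⟨congrArg (fun c => Hom.g c (0 : Fin (r.size + 1))) e,
    hom_ext (fun i => ?_) (fun i => ?_)⟩
  · exact Fin.succ_injective _ (congrArg (fun c => Hom.f c i.succ) e)
  · exact congrArg (fun c => Hom.g c i.succ) e

theorem consHom_ne_comp_front {r s : OI G} (g : G) (a : r ⟶ s)
    (b : (⟨r.size + 1⟩ : OI G) ⟶ s) : consHom g a ≠ b ≫ front s := fun h =>
  Fin.succ_ne_zero _ (congrArg (fun c => Hom.f c (0 : Fin (r.size + 1))) h).symm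

theorem exists_comp_front {r s : OI G} (a : r ⟶ shift.obj s)
    (h : ∀ i, Hom.f a i ≠ (0 : Fin (s.size + 1))) : ∃ b : r ⟶ s, a = b ≫ front s := by
  refine ⟨(⟨OrderEmbedding.ofStrictMono
    (fun i => Fin.pred (n := s.size) (Hom.f a i) (h i)) ?_, Hom.g a⟩ : Hom r s), ?_⟩
  · intro i j hij
    exact Fin.pred_lt_pred_iff.2 ((Hom.f a).strictMono hij)
  · refine hom_ext (fun i => ?_) (fun i => ?_)
    · exact (Fin.succ_pred (n := s.size) _ (h i)).symm
    · exact (one_mul _).symm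

theorem exists_comp_front_of_size_eq_zero {s : OI G}
    (a : (⟨0⟩ : OI G) ⟶ shift.obj s) : ∃ b, a = b ≫ front s :=
  exists_comp_front a fun i => i.elim0

/-- By monotonicity, only the least element of the source can hit the least element of the target.
This dichotomy is what makes derivatives of free modules free. -/
theorem exists_comp_front_or_consHom {r s : OI G} (a : shift.obj r ⟶ shift.obj s) :
    (∃ b, a = b ≫ front s) ∨ ∃ (g : G) (b : r ⟶ s), a = consHom g b := by
  by_cases h : Hom.f a (0 : Fin (r.size + 1)) = (0 : Fin (s.size + 1))
  · right
    have hpos : ∀ i : Fin r.size, Hom.f a i.succ ≠ (0 : Fin (s.size + 1)) := fun i hi =>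
      Fin.succ_ne_zero i ((Hom.f a).injective (hi.trans h.symm))
    refine ⟨Hom.g a (0 : Fin (r.size + 1)), (⟨OrderEmbedding.ofStrictMono
      (fun i => Fin.pred (n := s.size) (Hom.f a i.succ) (hpos i)) ?_,
      fun i => Hom.g a i.succ⟩ : Hom r s), ?_⟩
    · intro i j hij
      exact Fin.pred_lt_pred_iff.2 ((Hom.f a).strictMono (Fin.succ_lt_succ_iff.2 hij))
    · exact hom_ext_cons h rfl (fun i => (Fin.succ_pred (n := s.size) _ (hpos i)).symm)
        (fun _ => rfl)
  · left
    refine exists_comp_front a fun i hi => h ?_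
    refine le_antisymm ?_ (Fin.zero_le _)
    exact hi ▸ (Hom.f a).monotone (Fin.zero_le (n := r.size + 1) i)

theorem consHom_eq_comp_shift_map (g : G) {r s : OI G} (a : r ⟶ s) :
    consHom g a = consHom g (𝟙 r) ≫ shift.map a := by
  refine ((consHom_comp g 1 (𝟙 r) a).trans ?_).symm
  rw [one_mul, Category.id_comp]

end OI

/-! ### Submodules, exact sequences and generation degrees -/

namespace OIModule

variable {k : Type u} [CommRing k] {G : Type v} [Group G]

/-- A morphism of `OI_G`-modules given by linear maps compatible with the action. -/
def homMk {V W : OIModule.{u, v, w} k G} (φ : ∀ s, V.obj s →ₗ[k] W.obj s)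
    (h : ∀ {r s : OI G} (a : r ⟶ s) (x : V.obj r), φ s (V.map a x) = W.map a (φ r x)) :
    V ⟶ W where
  app s := ModuleCat.ofHom (φ s)
  naturality r s a := by
    ext x
    exact h a x

theorem hom_ext_apply {V W : OIModule.{u, v, w} k G} {f g : V ⟶ W}
    (h : ∀ s (x : V.obj s), f.app s x = g.app s x) : f = g := by
  ext s x
  exact h s x

theorem map_map (V : OIModule.{u, v, w} k G) {r s t : OI G} (a : r ⟶ s) (b : s ⟶ t)
    (x : V.obj r) : V.map b (V.map a x) = V.map (a ≫ b) x := by simp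

theorem app_map {V W : OIModule.{u, v, w} k G} (f : V ⟶ W) {r s : OI G} (a : r ⟶ s)
    (x : V.obj r) : f.app s (V.map a x) = W.map a (f.app r x) :=
  NatTrans.naturality_apply f a x

/-- The pair `A ⟶ B ⟶ C` is a short exact sequence of `OI_G`-modules. -/
structure IsShortExact {A B C : OIModule.{u, v, w} k G} (f : A ⟶ B) (g : B ⟶ C) : Prop where
  injective : ∀ s, Function.Injective (f.app s)
  surjective : ∀ s, Function.Surjective (g.app s)
  exact : ∀ s (x : B.obj s), g.app s x = 0 ↔ ∃ y, f.app s y = x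

namespace IsShortExact

variable {A B C : OIModule.{u, v, w} k G} {f : A ⟶ B} {g : B ⟶ C}

theorem comp_eq_zero (h : IsShortExact f g) : f ≫ g = 0 :=
  hom_ext_apply fun s x => (h.exact s _).2 ⟨x, rfl⟩

theorem shortExact (h : IsShortExact f g) :
    (ShortComplex.mk f g h.comp_eq_zero).ShortExact := by
  have hs : ∀ s, ((ShortComplex.mk f g h.comp_eq_zero).map
      ((evaluation (OI G) (ModuleCat.{w} k)).obj s)).Exact := fun s =>
    (ShortComplex.moduleCat_exact_iff _).2 fun x hx => (h.exact s x).1 hx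
  have hm : ∀ s, Mono (f.app s) := fun s => (ModuleCat.mono_iff_injective _).2 (h.injective s)
  have he : ∀ s, Epi (g.app s) := fun s => (ModuleCat.epi_iff_surjective _).2 (h.surjective s)
  refine { exact := ?_, mono_f := NatTrans.mono_of_mono_app f, epi_g := NatTrans.epi_of_epi_app g }
  rw [ShortComplex.exact_iff_isZero_homology]
  refine Functor.isZero _ fun s => ?_
  exact ((ShortComplex.exact_iff_isZero_homology _).1 (hs s)).of_iso
    (ShortComplex.mapHomologyIso _ ((evaluation (OI G) (ModuleCat.{w} k)).obj s)).symm

end IsShortExact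

theorem isIso_of_bijective {V W : OIModule.{u, v, w} k G} (f : V ⟶ W)
    (h : ∀ s, Function.Bijective (f.app s)) : IsIso f := by
  have : ∀ s, IsIso (f.app s) := fun s => (ConcreteCategory.isIso_iff_bijective _).2 (h s)
  exact NatIso.isIso_of_isIso_app f

theorem map_mem_decomposable (V : OIModule.{u, v, w} k G) {r s : OI G} (h : r.size < s.size)
    (a : r ⟶ s) (x : V.obj r) : V.map a x ∈ decomposable V s :=
  Submodule.mem_iSup_of_mem r (Submodule.mem_iSup_of_mem h
    (Submodule.mem_iSup_of_mem a ⟨x, rfl⟩))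

theorem decomposable_le_iff {V : OIModule.{u, v, w} k G} {s : OI G}
    {N : Submodule k (V.obj s)} :
    decomposable V s ≤ N ↔
      ∀ (r : OI G) (a : r ⟶ s) (x : V.obj r), r.size < s.size → V.map a x ∈ N := by
  refine ⟨fun h r a x hr => h (map_mem_decomposable V hr a x), fun h => ?_⟩
  refine iSup_le fun r => iSup_le fun hr => iSup_le fun a => ?_
  rintro _ ⟨x, rfl⟩
  exact h r a x hr

namespace Sub

variable {V : OIModule.{u, v, w} k G}

@[ext]
theorem ext {M N : Sub V} (h : ∀ s, M.val s = N.val s) : M = N := by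
  cases M
  cases N
  congr
  exact funext h

instance : PartialOrder (Sub V) where
  le M N := ∀ s, M.val s ≤ N.val s
  le_refl M s := le_rfl
  le_trans M N P h h' s := (h s).trans (h' s)
  le_antisymm M N h h' := ext fun s => le_antisymm (h s) (h' s)

/-- A submodule as an `OI_G`-module. -/
def toModule (N : Sub V) : OIModule.{u, v, w} k G where
  obj s := ModuleCat.of k (N.val s)
  map {r s} a := ModuleCat.ofHom ((V.map a).hom.restrict fun x hx => N.map_mem a x hx)
  map_id s := by
    ext x
    simp
  map_comp a b := by
    ext x
    simp

/-- The inclusion of a submodule. -/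
def incl (N : Sub V) : N.toModule ⟶ V :=
  homMk (fun s => (N.val s).subtype) fun _ _ => rfl

theorem incl_injective (N : Sub V) (s : OI G) : Function.Injective (N.incl.app s) :=
  Subtype.val_injective

/-- Morphisms into a submodule. -/
def lift (N : Sub V) {W : OIModule.{u, v, w} k G} (f : W ⟶ V)
    (h : ∀ s (x : W.obj s), f.app s x ∈ N.val s) : W ⟶ N.toModule :=
  homMk (fun s => (f.app s).hom.codRestrict (N.val s) (h s)) fun a x =>
    Subtype.ext (app_map f a x)

theorem incl_app_mem (N : Sub V) (s : OI G) (x : N.toModule.obj s) :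
    N.incl.app s x ∈ N.val s := Subtype.property _

/-- The kernel of a morphism. -/
def ker {W : OIModule.{u, v, w} k G} (f : V ⟶ W) : Sub V where
  val s := LinearMap.ker (f.app s).hom
  map_mem a x hx := by
    have hx' : f.app _ x = 0 := hx
    refine (app_map f a x).trans ?_
    rw [hx', map_zero]

theorem isShortExact_ker {W : OIModule.{u, v, w} k G} (f : V ⟶ W)
    (hf : ∀ s, Function.Surjective (f.app s)) : IsShortExact (ker f).incl f where
  injective := incl_injective _
  surjective := hf
  exact s x := ⟨fun h => ⟨⟨x, h⟩, rfl⟩, by rintro ⟨y, rfl⟩; exact y.2⟩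

/-- The submodule of elements of `V` obtained from elements of size at most `n`. -/
def generatedUpTo (V : OIModule.{u, v, w} k G) (n : ℕ) : Sub V where
  val s := ⨆ (r : OI G) (_ : r.size ≤ n) (a : r ⟶ s), LinearMap.range (V.map a).hom
  map_mem {s t} b x hx := by
    suffices h : (⨆ (r : OI G) (_ : r.size ≤ n) (a : r ⟶ s), LinearMap.range (V.map a).hom) ≤
        Submodule.comap (V.map b).hom (⨆ (r : OI G) (_ : r.size ≤ n) (a : r ⟶ t),
          LinearMap.range (V.map a).hom) from h hx
    refine iSup_le fun r => iSup_le fun hr => iSup_le fun a => ?_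
    rintro _ ⟨y, rfl⟩
    refine Submodule.mem_iSup_of_mem r (Submodule.mem_iSup_of_mem hr
      (Submodule.mem_iSup_of_mem (a ≫ b) ⟨y, ?_⟩))
    exact (map_map V a b y).symm

theorem map_mem_generatedUpTo (V : OIModule.{u, v, w} k G) {n : ℕ} {r s : OI G}
    (h : r.size ≤ n) (a : r ⟶ s) (x : V.obj r) : V.map a x ∈ (generatedUpTo V n).val s :=
  Submodule.mem_iSup_of_mem r (Submodule.mem_iSup_of_mem h
    (Submodule.mem_iSup_of_mem a ⟨x, rfl⟩))

theorem mem_generatedUpTo (V : OIModule.{u, v, w} k G) {n : ℕ} {s : OI G}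
    (h : s.size ≤ n) (x : V.obj s) : x ∈ (generatedUpTo V n).val s := by
  simpa using map_mem_generatedUpTo V h (𝟙 s) x

theorem generatedUpTo_val_le_decomposable (V : OIModule.{u, v, w} k G) {n : ℕ} {s : OI G}
    (h : n < s.size) : (generatedUpTo V n).val s ≤ decomposable V s := by
  refine iSup_le fun r => iSup_le fun hr => iSup_le fun a => ?_
  rintro _ ⟨y, rfl⟩
  exact map_mem_decomposable V (hr.trans_lt h) a y

end Sub

/-- A module is generated in bounded degree if it has no new generators in large degrees. -/
def GeneratedInDegreesLE (V : OIModule.{u, v, w} k G) (n : ℕ) : Prop :=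
  ∀ s : OI G, n < s.size → decomposable V s = ⊤

theorem IsFinitelyGenerated.exists_generatedInDegreesLE {V : OIModule.{u, v, w} k G}
    (hV : V.IsFinitelyGenerated) : ∃ n, GeneratedInDegreesLE V n := by
  obtain ⟨T, hT, h⟩ := hV
  obtain ⟨n, hn⟩ := (hT.image fun x => x.1.size).bddAbove
  refine ⟨n, fun s hs => top_le_iff.1 ?_⟩
  rw [← h (Sub.generatedUpTo V n)
    (fun x hx => Sub.mem_generatedUpTo V (hn ⟨x, hx, rfl⟩) x.2) s]
  exact Sub.generatedUpTo_val_le_decomposable V hs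

/-- The submodules of `X` generated in degrees at most n form an ascending chain in `Sub V`; where
it becomes stationary, no new generators appear. -/
theorem exists_generatedInDegreesLE_toModule {V : OIModule.{u, v, w} k G}
    [WellFoundedGT (Sub V)] (X : Sub V) : ∃ n, GeneratedInDegreesLE X.toModule n := by
  let Y : ℕ →o Sub V :=
    { toFun := fun n =>
        { val := fun s => ((Sub.generatedUpTo X.toModule n).val s).map (X.val s).subtype
          map_mem := by
            rintro r s a _ ⟨x, hx, rfl⟩
            exact ⟨X.toModule.map a x, (Sub.generatedUpTo X.toModule n).map_mem a x hx, rfl⟩ }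
      monotone' := fun m n hmn s => Submodule.map_mono
        (iSup_mono fun r => iSup_mono' fun hr => ⟨hr.trans hmn, le_rfl⟩) }
  obtain ⟨n, hn⟩ := WellFoundedGT.monotone_chain_condition Y
  refine ⟨n, fun s hs => top_le_iff.1 fun x _ => ?_⟩
  have hx : X.incl.app s x ∈ (Y s.size).val s :=
    ⟨x, Sub.mem_generatedUpTo X.toModule le_rfl x, rfl⟩
  rw [← hn s.size hs.le] at hx
  obtain ⟨y, hy, hyx⟩ := hx
  obtain rfl : y = x := Subtype.ext hyx
  exact Sub.generatedUpTo_val_le_decomposable X.toModule hs hy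

end OIModule

/-! ### Bases of cokernels -/

section QuotientBasis

open Classical in
/-- If a linear map sends a basis injectively to a part of a basis, then the rest of the latter
basis is a basis of the cokernel. -/
theorem Module.Basis.exists_basis_quotient_range {R M N ι ι' κ : Type*} [CommRing R]
    [AddCommGroup M] [Module R M] [AddCommGroup N] [Module R N] (bM : Module.Basis ι R M)
    (bN : Module.Basis κ R N) (f : M →ₗ[R] N) (σ : ι → κ) (τ : ι' → κ)
    (hf : ∀ i, f (bM i) = bN (σ i)) (hτ : Function.Injective τ)
    (hστ : ∀ i i', τ i' ≠ σ i) (h : ∀ j, (∃ i, j = σ i) ∨ ∃ i', j = τ i') :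
    ∃ b : Module.Basis ι' R (N ⧸ LinearMap.range f), ∀ i', b i' = Submodule.Quotient.mk
      (bN (τ i')) := by
  -- `φ` kills the basis vectors in the image of `σ` and reads off the coordinates along `τ`; modulo
  -- the range of `f` it is inverse to `ψ`.
  let φ : N →ₗ[R] (ι' →₀ R) := bN.constr R fun j =>
    if h : ∃ i', j = τ i' then Finsupp.single h.choose 1 else 0
  let ψ : (ι' →₀ R) →ₗ[R] N := Finsupp.linearCombination R (bN ∘ τ)
  have hφτ : ∀ i', φ (bN (τ i')) = Finsupp.single i' 1 := fun i' => by
    have h : ∃ i'', τ i' = τ i'' := ⟨i', rfl⟩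
    have : h.choose = i' := (hτ h.choose_spec).symm
    simp only [φ, Module.Basis.constr_basis, dif_pos h, this]
  have hφσ : ∀ i, φ (bN (σ i)) = 0 := fun i => by
    have h : ¬ ∃ i', σ i = τ i' := fun ⟨i', h⟩ => hστ i i' h.symm
    simp only [φ, Module.Basis.constr_basis, dif_neg h]
  have hψ : ∀ i', ψ (Finsupp.single i' 1) = bN (τ i') := fun i' => by simp [ψ]
  have hle : LinearMap.range f ≤ LinearMap.ker φ := by
    rw [LinearMap.range_le_ker_iff]
    refine bM.ext fun i => ?_
    simp [hf, hφσ]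
  let e : (N ⧸ LinearMap.range f) ≃ₗ[R] (ι' →₀ R) := LinearEquiv.ofLinearMap
    ((LinearMap.range f).liftQ φ hle) ((LinearMap.range f).mkQ ∘ₗ ψ)
    (by
      ext i' : 2
      simp [hψ, hφτ])
    (by
      refine Submodule.linearMap_qext _ (bN.ext fun j => ?_)
      obtain ⟨i, rfl⟩ | ⟨i', rfl⟩ := h j
      · have h0 : (LinearMap.range f).mkQ (bN (σ i)) = 0 :=
          (Submodule.Quotient.mk_eq_zero _).2 ⟨_, hf i⟩
        simpa [hφσ] using h0.symm
      · simp [hφτ, hψ])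
  refine ⟨Module.Basis.ofRepr e, fun i' => ?_⟩
  simp [e, hψ]

end QuotientBasis

/-! ### The derivative of a module -/

namespace OIModule

variable {k : Type u} [CommRing k] {G : Type v} [Group G]

/-- The natural transformation from a module to its shift. -/
def frontTrans (V : OIModule.{u, v, w} k G) : V ⟶ OI.shift ⋙ V :=
  homMk (fun s => (V.map (OI.front s)).hom) fun {r s} a x => by
    refine (map_map V a (OI.front s) x).trans ?_
    rw [OI.front_naturality a]
    exact (map_map V (OI.front r) (OI.shift.map a) x).symm

/-- The derivative of an `OI_G`-module: the cokernel of the map to its shift. -/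
def deriv (V : OIModule.{u, v, w} k G) : OIModule.{u, v, w} k G where
  obj s := ModuleCat.of k
    (V.obj (OI.shift.obj s) ⧸ LinearMap.range ((frontTrans V).app s).hom)
  map {r s} a := ModuleCat.ofHom (Submodule.mapQ _ _ (V.map (OI.shift.map a)).hom (by
    rintro _ ⟨x, rfl⟩
    exact ⟨V.map a x, app_map (frontTrans V) a x⟩))
  map_id s := by
    apply ModuleCat.hom_ext
    apply Submodule.linearMap_qext
    ext x
    simp
  map_comp a b := by
    apply ModuleCat.hom_ext
    apply Submodule.linearMap_qext
    ext x
    simp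

/-- The projection from the shift to the derivative. -/
def derivProj (V : OIModule.{u, v, w} k G) : OI.shift ⋙ V ⟶ deriv V :=
  homMk (fun s => Submodule.mkQ (LinearMap.range ((frontTrans V).app s).hom)) fun _ _ => rfl

theorem derivProj_surjective (V : OIModule.{u, v, w} k G) (s : OI G) :
    ∀ y, ∃ x : V.obj (OI.shift.obj s), (derivProj V).app s x = y :=
  Submodule.mkQ_surjective (LinearMap.range ((frontTrans V).app s).hom)

theorem derivProj_eq_zero_iff (V : OIModule.{u, v, w} k G) (s : OI G)
    (x : V.obj (OI.shift.obj s)) :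
    (derivProj V).app s x = 0 ↔ ∃ y : V.obj s, V.map (OI.front s) y = x :=
  Submodule.Quotient.mk_eq_zero _

/-- A module is front-injective if it embeds into its shift. -/
def FrontInjective (V : OIModule.{u, v, w} k G) : Prop :=
  ∀ s : OI G, Function.Injective (V.map (OI.front s))

theorem FrontInjective.isShortExact {V : OIModule.{u, v, w} k G} (h : FrontInjective V) :
    IsShortExact (frontTrans V) (derivProj V) where
  injective := h
  surjective := derivProj_surjective V
  exact := derivProj_eq_zero_iff V

theorem FrontInjective.of_injective {V W : OIModule.{u, v, w} k G} (h : FrontInjective W)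
    (f : V ⟶ W) (hf : ∀ s, Function.Injective (f.app s)) : FrontInjective V := fun s x y hxy => by
  refine hf s (h s ?_)
  rw [← app_map, ← app_map, hxy]

/-- The derivative of a morphism. -/
def derivMap {V W : OIModule.{u, v, w} k G} (f : V ⟶ W) : deriv V ⟶ deriv W :=
  homMk (fun s => Submodule.mapQ _ _ (f.app (OI.shift.obj s)).hom (by
      rintro _ ⟨x, rfl⟩
      exact ⟨f.app s x, (app_map f (OI.front s) x).symm⟩)) fun {r s} a x => by
    obtain ⟨x, rfl⟩ := derivProj_surjective V r x
    exact congrArg (Submodule.Quotient.mk) (app_map f (OI.shift.map a) x)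

theorem derivMap_app_derivProj {V W : OIModule.{u, v, w} k G} (f : V ⟶ W) (s : OI G)
    (x : V.obj (OI.shift.obj s)) :
    (derivMap f).app s ((derivProj V).app s x) =
      (derivProj W).app s (f.app (OI.shift.obj s) x) := rfl

/-- Snake lemma for the maps to the shifts: the only obstruction to exactness on the left is the
kernel of `C` → Σ`C`, which is zero by `hC`. -/
theorem IsShortExact.deriv {A B C : OIModule.{u, v, w} k G} {f : A ⟶ B} {g : B ⟶ C}
    (h : IsShortExact f g) (hC : FrontInjective C) :
    IsShortExact (derivMap f) (derivMap g) where
  injective s := by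
    refine (injective_iff_map_eq_zero ((derivMap f).app s).hom).2 fun y hy => ?_
    obtain ⟨a, rfl⟩ := derivProj_surjective A s y
    obtain ⟨b, hb⟩ := (derivProj_eq_zero_iff B s _).1 hy
    have hgb : g.app s b = 0 := by
      refine hC s ?_
      rw [map_zero, ← app_map, hb]
      exact (h.exact _ _).2 ⟨a, rfl⟩
    obtain ⟨a', rfl⟩ := (h.exact s b).1 hgb
    refine (derivProj_eq_zero_iff A s a).2 ⟨a', h.injective _ ?_⟩
    rw [app_map, hb]
  surjective s y := by
    obtain ⟨c, rfl⟩ := derivProj_surjective C s y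
    obtain ⟨b, rfl⟩ := h.surjective _ c
    exact ⟨(derivProj B).app s b, rfl⟩
  exact s y := by
    constructor
    · intro hy
      obtain ⟨b, rfl⟩ := derivProj_surjective B s y
      obtain ⟨c, hc⟩ := (derivProj_eq_zero_iff C s _).1 hy
      obtain ⟨b', rfl⟩ := h.surjective _ c
      have : g.app (OI.shift.obj s) (b - B.map (OI.front s) b') = 0 := by
        rw [map_sub, app_map, hc]
        exact sub_self _
      obtain ⟨a, ha⟩ := (h.exact _ _).1 this
      refine ⟨(derivProj A).app s a, ?_⟩
      rw [derivMap_app_derivProj, ha]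
      have h0 : (derivProj B).app s (B.map (OI.front s) b') = 0 :=
        (derivProj_eq_zero_iff B s _).2 ⟨b', rfl⟩
      exact (map_sub ((derivProj B).app s).hom b _).trans (by
        exact (congrArg (_ - ·) h0).trans (sub_zero _))
    · rintro ⟨a, rfl⟩
      obtain ⟨a, rfl⟩ := derivProj_surjective A s a
      have : g.app _ (f.app _ a) = 0 := (h.exact (OI.shift.obj s) _).2 ⟨a, rfl⟩
      rw [derivMap_app_derivProj, derivMap_app_derivProj, this]
      exact map_zero ((derivProj C).app s).hom

/-- The new generators of the derivative are those of the module, in one degree less. -/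
theorem derivProj_mem_decomposable_iff (V : OIModule.{u, v, w} k G) (s : OI G)
    (x : V.obj (OI.shift.obj s)) :
    (derivProj V).app s x ∈ decomposable (deriv V) s ↔
      x ∈ decomposable V (OI.shift.obj s) := by
  constructor
  · have h : decomposable (deriv V) s ≤
        (decomposable V (OI.shift.obj s)).map ((derivProj V).app s).hom := by
      refine decomposable_le_iff.2 fun r a y hr => ?_
      obtain ⟨y, rfl⟩ := derivProj_surjective V r y
      exact ⟨V.map (OI.shift.map a) y,
        map_mem_decomposable V (Nat.succ_lt_succ hr) (OI.shift.map a) y, rfl⟩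
    intro hx
    obtain ⟨(y : V.obj (OI.shift.obj s)), hy, hxy⟩ := h hx
    have h0 : (derivProj V).app s (x - y) = 0 :=
      (map_sub ((derivProj V).app s).hom x y).trans (sub_eq_zero.2 hxy.symm)
    obtain ⟨z, hz⟩ := (derivProj_eq_zero_iff V s _).1 h0
    rw [← sub_add_cancel x y, ← hz]
    exact Submodule.add_mem _
      (map_mem_decomposable V (Nat.lt_succ_self s.size) (OI.front s) z) hy
  · intro hx
    suffices h : decomposable V (OI.shift.obj s) ≤
        (decomposable (deriv V) s).comap ((derivProj V).app s).hom from h hx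
    refine decomposable_le_iff.2 fun r a y hr => ?_
    have key : ∀ b : r ⟶ s, V.map (b ≫ OI.front s) y ∈
        (decomposable (deriv V) s).comap ((derivProj V).app s).hom := fun b => by
      have : (derivProj V).app s (V.map (b ≫ OI.front s) y) = 0 :=
        (derivProj_eq_zero_iff V s _).2 ⟨V.map b y, map_map V b _ y⟩
      refine Submodule.mem_comap.2 ?_
      exact this ▸ Submodule.zero_mem _
    -- Morphisms that miss the least element vanish in the derivative. One that hits it is `consHom
    -- g b`, which factors through a shifted morphism `b` whose source is still smaller than `s`.
    -- From size 0 nothing can hit it.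
    obtain ⟨_ | n⟩ := r
    · obtain ⟨b, rfl⟩ := OI.exists_comp_front_of_size_eq_zero a
      exact key b
    · obtain ⟨b, rfl⟩ | ⟨g, b, rfl⟩ := OI.exists_comp_front_or_consHom (r := ⟨n⟩) a
      · exact key b
      · have e : V.map (OI.consHom g b) y =
            V.map (OI.shift.map b) (V.map (OI.consHom g (𝟙 _)) y) := by
          rw [OI.consHom_eq_comp_shift_map]
          exact (map_map V _ _ y).symm
        refine Eq.mpr (congrArg (fun z =>
          z ∈ (decomposable (deriv V) s).comap ((derivProj V).app s).hom) e) ?_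
        exact map_mem_decomposable (deriv V) (r := ⟨n⟩) (Nat.lt_of_succ_lt_succ hr) b
          ((derivProj V).app ⟨n⟩ (V.map (OI.consHom g (𝟙 _)) y))

/-! ### Free modules -/

/-- A module is free on the sets `B r` of generators in degree `r`. -/
structure FreeBasis (P : OIModule.{u, v, w} k G) where
  /-- the generators in degree `r` -/
  B : ℕ → Type (max v w)
  /-- the basis of `P_s` consisting of the images of the generators -/
  basis : ∀ s : OI G, Module.Basis (Σ r : ℕ, B r × ((⟨r⟩ : OI G) ⟶ s)) k (P.obj s)
  map_basis : ∀ {s t : OI G} (a : s ⟶ t) (r : ℕ) (b : B r) (f : (⟨r⟩ : OI G) ⟶ s),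
    P.map a (basis s ⟨r, b, f⟩) = basis t ⟨r, b, f ≫ a⟩

namespace FreeBasis

variable {P : OIModule.{u, v, w} k G} (F : FreeBasis P)

/-- The morphism given by the images of the generators. -/
noncomputable def desc {W : OIModule.{u, v, w} k G} (m : ∀ r, F.B r → W.obj ⟨r⟩) : P ⟶ W :=
  homMk (fun s => (F.basis s).constr k fun i => W.map i.2.2 (m i.1 i.2.1)) fun {r s} a x => by
    suffices h : ((F.basis s).constr k fun i => W.map i.2.2 (m i.1 i.2.1)) ∘ₗ (P.map a).hom =
        (W.map a).hom ∘ₗ (F.basis r).constr k fun i => W.map i.2.2 (m i.1 i.2.1) from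
      LinearMap.congr_fun h x
    refine (F.basis r).ext fun ⟨n, b, f⟩ => ?_
    have := F.map_basis a n b f
    simp only [LinearMap.comp_apply, Module.Basis.constr_basis]
    erw [this]
    simp only [Module.Basis.constr_basis]
    exact (map_map W f a _).symm

theorem desc_basis {W : OIModule.{u, v, w} k G} (m : ∀ r, F.B r → W.obj ⟨r⟩) (s : OI G) (r : ℕ)
    (b : F.B r) (f : (⟨r⟩ : OI G) ⟶ s) :
    (F.desc m).app s (F.basis s ⟨r, b, f⟩) = W.map f (m r b) :=
  (F.basis s).constr_basis k _ _

theorem hom_ext {W : OIModule.{u, v, w} k G} {f g : P ⟶ W}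
    (h : ∀ r (b : F.B r), f.app ⟨r⟩ (F.basis ⟨r⟩ ⟨r, b, 𝟙 _⟩) =
      g.app ⟨r⟩ (F.basis ⟨r⟩ ⟨r, b, 𝟙 _⟩)) : f = g := by
  ext s : 2
  apply ModuleCat.hom_ext
  refine (F.basis s).ext fun ⟨r, b, a⟩ => ?_
  have e : F.basis s ⟨r, b, a⟩ = P.map a (F.basis ⟨r⟩ ⟨r, b, 𝟙 _⟩) := by
    rw [F.map_basis, Category.id_comp]
  rw [e]
  exact (app_map f a _).trans ((congrArg (W.map a) (h r b)).trans (app_map g a _).symm)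

include F in
theorem projective : Projective P where
  factors {E X} f e _ := by
    have he : ∀ s, Function.Surjective (e.app s) := fun s =>
      (ModuleCat.epi_iff_surjective _).1 inferInstance
    choose m hm using fun r (b : F.B r) => he ⟨r⟩ (f.app ⟨r⟩ (F.basis ⟨r⟩ ⟨r, b, 𝟙 _⟩))
    refine ⟨F.desc m, F.hom_ext fun r b => ?_⟩
    refine (congrArg (e.app ⟨r⟩) (F.desc_basis m ⟨r⟩ r b (𝟙 _))).trans ?_
    rw [CategoryTheory.Functor.map_id]
    exact hm r b

-- Composition with `front s` is injective on morphisms, so the map to the shift sends the basis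
-- injectively into a basis.
include F in
theorem frontInjective : FrontInjective P := fun s => by
  let σ : (Σ r : ℕ, F.B r × ((⟨r⟩ : OI G) ⟶ s)) →
    (Σ r : ℕ, F.B r × ((⟨r⟩ : OI G) ⟶ OI.shift.obj s)) := fun i => ⟨i.1, i.2.1, i.2.2 ≫ OI.front s⟩
  have hσ : Function.Injective σ := by
    rintro ⟨r, b, f⟩ ⟨r', b', f'⟩ h
    simp only [σ, Sigma.mk.injEq] at h
    obtain ⟨rfl, h⟩ := h
    simp only [heq_eq_eq, Prod.mk.injEq] at h
    obtain ⟨rfl, h⟩ := h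
    rw [OI.comp_front_injective h]
  have h : (F.basis (OI.shift.obj s)).repr.toLinearMap ∘ₗ (P.map (OI.front s)).hom =
      Finsupp.lmapDomain k k σ ∘ₗ (F.basis s).repr.toLinearMap := by
    refine (F.basis s).ext fun ⟨r, b, f⟩ => ?_
    have := F.map_basis (OI.front s) r b f
    simp only [LinearMap.comp_apply]
    erw [this]
    simp [σ]
  have hinj : Function.Injective ((F.basis (OI.shift.obj s)).repr.toLinearMap ∘ₗ
      (P.map (OI.front s)).hom) := by
    rw [h]
    exact (Finsupp.mapDomain_injective hσ).comp (F.basis s).repr.injective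
  exact Function.Injective.of_comp hinj

/-- The derivative of a free module is free. -/
theorem exists_deriv :
    ∃ F' : FreeBasis (deriv P), F'.B = fun r => F.B (r + 1) × G := by
  have h : ∀ s : OI G, ∃ b : Module.Basis (Σ r : ℕ, (F.B (r + 1) × G) × ((⟨r⟩ : OI G) ⟶ s)) k
      ((deriv P).obj s), ∀ i, b i = (derivProj P).app s
        (F.basis (OI.shift.obj s) ⟨i.1 + 1, i.2.1.1, OI.consHom i.2.1.2 i.2.2⟩) := by
    intro s
    let σ : (Σ r : ℕ, F.B r × ((⟨r⟩ : OI G) ⟶ s)) →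
        (Σ r : ℕ, F.B r × ((⟨r⟩ : OI G) ⟶ OI.shift.obj s)) :=
      fun i => ⟨i.1, i.2.1, i.2.2 ≫ OI.front s⟩
    let τ : (Σ r : ℕ, (F.B (r + 1) × G) × ((⟨r⟩ : OI G) ⟶ s)) →
        (Σ r : ℕ, F.B r × ((⟨r⟩ : OI G) ⟶ OI.shift.obj s)) :=
      fun i => ⟨i.1 + 1, i.2.1.1, OI.consHom i.2.1.2 i.2.2⟩
    refine Module.Basis.exists_basis_quotient_range (F.basis s) (F.basis (OI.shift.obj s))
      ((frontTrans P).app s).hom σ τ ?_ ?_ ?_ ?_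
    · rintro ⟨r, b, f⟩
      exact F.map_basis (OI.front s) r b f
    · rintro ⟨r, ⟨b, g⟩, f⟩ ⟨r', ⟨b', g'⟩, f'⟩ h
      simp only [τ, Sigma.mk.injEq] at h
      obtain ⟨hr, h⟩ := h
      obtain rfl : r = r' := Nat.succ_injective hr
      replace h := eq_of_heq h
      obtain rfl : b = b' := congrArg Prod.fst h
      obtain ⟨rfl, rfl⟩ := OI.consHom_injective (congrArg Prod.snd h)
      rfl
    · rintro ⟨r, b, f⟩ ⟨r', ⟨b', g'⟩, f'⟩ h
      simp only [σ, τ, Sigma.mk.injEq] at h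
      obtain ⟨rfl, h⟩ := h
      exact OI.consHom_ne_comp_front g' f' f (congrArg Prod.snd (eq_of_heq h))
    -- Basis elements whose morphism misses the least element come from `P`; the others are indexed
    -- by a label in `G` and a morphism from one size less, so they are the new basis.
    · rintro ⟨_ | r, b, f⟩
      · obtain ⟨f', rfl⟩ := OI.exists_comp_front_of_size_eq_zero f
        exact Or.inl ⟨⟨0, b, f'⟩, rfl⟩
      · obtain ⟨f', rfl⟩ | ⟨g, f', rfl⟩ := OI.exists_comp_front_or_consHom (r := ⟨r⟩) f
        · exact Or.inl ⟨⟨r + 1, b, f'⟩, rfl⟩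
        · exact Or.inr ⟨⟨r, (b, g), f'⟩, rfl⟩
  choose b hb using h
  refine ⟨⟨fun r => F.B (r + 1) × G, b, fun {s t} a r c f => ?_⟩, rfl⟩
  rw [hb, hb, ← app_map]
  congr 1
  refine (F.map_basis (OI.shift.map a) _ _ _).trans ?_
  congr 3
  refine (OI.consHom_comp c.2 1 f a).trans ?_
  rw [one_mul]

end FreeBasis

/-- Free modules exist. -/
theorem exists_freeBasis [Finite G] [Small.{w} k] (B : ℕ → Type w) :
    ∃ (P : OIModule.{u, v, w} k G) (F : FreeBasis P), F.B = fun r => ULift.{v} (B r) := by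
  have hsmall : ∀ r s : OI G, Small.{w} (r ⟶ s) := fun r s => Countable.toSmall _
  let I : OI G → Type _ := fun s => Σ r : ℕ, ULift.{v} (B r) × ((⟨r⟩ : OI G) ⟶ s)
  have hI : ∀ s, Small.{w} (I s) := fun s => inferInstance
  -- Morphism sets are finite, so the index sets and `k` can be shrunk for the values to live in
  -- universe `w`.
  let M : OI G → Type w := fun s => Shrink.{w} (I s) →₀ Shrink.{w} k
  let b : ∀ s, Module.Basis (I s) k (M s) := fun s =>
    (Module.Basis.ofRepr (Finsupp.mapRange.linearEquiv (Shrink.linearEquiv k k))).reindex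
      (equivShrink (I s)).symm
  let c : ∀ {s t : OI G} (_ : s ⟶ t), M s →ₗ[k] M t := fun {s t} a =>
    (b s).constr k fun i => b t ⟨i.1, i.2.1, i.2.2 ≫ a⟩
  have hc : ∀ {s t : OI G} (a : s ⟶ t) (i : I s), c a (b s i) = b t ⟨i.1, i.2.1, i.2.2 ≫ a⟩ :=
    fun {s t} a i => (b s).constr_basis k _ i
  refine ⟨
    { obj := fun s => ModuleCat.of k (M s)
      map := fun a => ModuleCat.ofHom (c a)
      map_id := fun s => by
        apply ModuleCat.hom_ext
        refine (b s).ext fun i => (hc _ i).trans ?_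
        simp
      map_comp := fun {r s t} a a' => by
        apply ModuleCat.hom_ext
        refine (b r).ext fun i => (hc _ i).trans ?_
        rw [ModuleCat.hom_comp, LinearMap.comp_apply]
        refine Eq.trans ?_ (congrArg (c a') (hc a i)).symm
        rw [hc, Category.assoc] },
    { B := _, basis := b, map_basis := fun a r x f => hc a ⟨r, x, f⟩ }, rfl⟩

end OIModule

/-! ### Coinduced modules as right adjoints to homology in one degree -/

namespace OIModule

variable {k : Type u} [CommRing k] {G : Type v} [Group G] [Finite G]

instance small_hom (r s : OI G) : Small.{w} (r ⟶ s) := Countable.toSmall _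

/-- The module coinduced from a `k`-module `I` at the object `s`. -/
noncomputable def coextend (s : OI G) (I : ModuleCat.{w} k) : OIModule.{u, v, w} k G where
  obj t := ModuleCat.of k (Shrink.{w} (t ⟶ s) → I)
  map {t t'} b := ModuleCat.ofHom
    (LinearMap.funLeft k I fun a => equivShrink (t ⟶ s) (b ≫ (equivShrink (t' ⟶ s)).symm a))
  map_id t := by
    apply ModuleCat.hom_ext
    ext h a
    simp [LinearMap.funLeft]
  map_comp b b' := by
    apply ModuleCat.hom_ext
    ext h a
    simp [LinearMap.funLeft]

theorem coextend_map_apply (s : OI G) (I : ModuleCat.{w} k) {t t' : OI G} (b : t ⟶ t')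
    (h : Shrink.{w} (t ⟶ s) → I) (a : t' ⟶ s) :
    (show Shrink.{w} (t' ⟶ s) → I from (coextend s I).map b h) (equivShrink _ a) =
      h (equivShrink _ (b ≫ a)) := by
  change h _ = _
  simp

/-- The largest submodule of `coextend s I` which is concentrated in degree `s`. -/
noncomputable def coindSub (s : OI G) (I : ModuleCat.{w} k) : Sub (coextend.{u, v, w} s I) where
  -- This is 0 for t < s and everything otherwise; above s, `coextend` already vanishes because
  -- there are no morphisms to `s`.
  val t := ⨅ _ : t.size < s.size, ⊥
  map_mem {r t} a x hx := by
    simp only [Submodule.mem_iInf, Submodule.mem_bot] at hx ⊢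
    intro ht
    rw [hx ((OI.size_le_of_hom a).trans_lt ht), map_zero]

/-- The right adjoint of `V ↦ H₀(V)_s`: the coinduced module concentrated in degree `s`. -/
noncomputable def coind (s : OI G) (I : ModuleCat.{w} k) : OIModule.{u, v, w} k G :=
  (coindSub s I).toModule

/-- The counit of `coind`. -/
noncomputable def coindEval (s : OI G) (I : ModuleCat.{w} k) :
    (coind.{u, v, w} s I).obj s →ₗ[k] I :=
  LinearMap.proj (φ := fun _ : Shrink.{w} (s ⟶ s) => I) (equivShrink _ (𝟙 s)) ∘ₗ
    ((coindSub s I).val s).subtype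

theorem coindEval_map {s t : OI G} {I : ModuleCat.{w} k} (a : t ⟶ s)
    (h : (coind.{u, v, w} s I).obj t) :
    coindEval s I ((coind s I).map a h) =
      (show Shrink.{w} (t ⟶ s) → I from (coindSub s I).incl.app t h) (equivShrink _ a) := by
  refine (coextend_map_apply s I a ((coindSub s I).incl.app t h) (𝟙 s)).trans ?_
  rw [Category.comp_id]

theorem decomposable_le_ker_coindEval (s : OI G) (I : ModuleCat.{w} k) :
    decomposable (coind.{u, v, w} s I) s ≤ LinearMap.ker (coindEval s I) := by
  refine decomposable_le_iff.2 fun r a x hr => ?_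
  refine (coindEval_map a x).trans ?_
  have h := (coindSub s I).incl_app_mem r x
  simp only [coindSub, Submodule.mem_iInf, Submodule.mem_bot] at h
  exact congrFun (h hr) _

theorem coind_hom_ext {V : OIModule.{u, v, w} k G} {s : OI G} {I : ModuleCat.{w} k}
    {f g : V ⟶ coind s I}
    (h : ∀ x : V.obj s, coindEval s I (f.app s x) = coindEval s I (g.app s x)) : f = g := by
  refine hom_ext_apply fun t x => (coindSub s I).incl_injective t (funext fun a => ?_)
  obtain ⟨a, rfl⟩ := (equivShrink (t ⟶ s)).surjective a
  refine (coindEval_map a (f.app t x)).symm.trans (Eq.trans ?_ (coindEval_map a (g.app t x)))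
  rw [← app_map, ← app_map, h]

theorem exists_hom_coind {V : OIModule.{u, v, w} k G} {s : OI G} {I : ModuleCat.{w} k}
    (l : V.obj s →ₗ[k] I) (hl : decomposable V s ≤ LinearMap.ker l) :
    ∃ f : V ⟶ coind s I, ∀ x, coindEval s I (f.app s x) = l x := by
  let f₀ : V ⟶ coextend s I := homMk
    (fun t => LinearMap.pi (φ := fun _ : Shrink.{w} (t ⟶ s) => I)
      fun a => l ∘ₗ (V.map ((equivShrink _).symm a)).hom) fun {r t} b x => by
      refine funext fun (a : Shrink.{w} (t ⟶ s)) => ?_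
      obtain ⟨a, rfl⟩ := (equivShrink (t ⟶ s)).surjective a
      refine Eq.trans ?_ (coextend_map_apply s I b _ a).symm
      change l (V.map ((equivShrink _).symm (equivShrink _ a)) (V.map b x)) =
        l (V.map ((equivShrink _).symm (equivShrink _ (b ≫ a))) x)
      simp
  refine ⟨(coindSub s I).lift f₀ fun t x => ?_, fun x => ?_⟩
  · simp only [coindSub, Submodule.mem_iInf, Submodule.mem_bot]
    intro ht
    exact funext fun (a : Shrink.{w} (t ⟶ s)) =>
      hl (map_mem_decomposable V ht ((equivShrink _).symm a) x)
  · change l (V.map ((equivShrink (s ⟶ s)).symm (equivShrink _ (𝟙 s))) x) = l x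
    simp

theorem decomposable_le_ker_coindEval_comp {V : OIModule.{u, v, w} k G} {s : OI G}
    {I : ModuleCat.{w} k} (f : V ⟶ coind s I) :
    decomposable V s ≤ LinearMap.ker (coindEval s I ∘ₗ (f.app s).hom) := fun _ hx =>
  decomposable_le_ker_coindEval s I (decomposable_le_comap_app f s hx)

theorem eq_zero_of_decomposable_eq_top {V : OIModule.{u, v, w} k G} {s : OI G}
    (h : decomposable V s = ⊤) {I : ModuleCat.{w} k} (f : V ⟶ coind s I) : f = 0 := by
  refine coind_hom_ext fun x => ?_
  have hx : x ∈ decomposable V s := h ▸ Submodule.mem_top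
  exact (decomposable_le_ker_coindEval_comp f hx).trans (map_zero (coindEval s I)).symm

/-- Together with `exists_hom_of_deriv` this identifies Hom(V, coind (s+1) I) with Hom(DV, coind s
I): both consist of the linear maps from V_{s+1} to I that kill decomposables. -/
theorem exists_hom_deriv {V : OIModule.{u, v, w} k G} {s : OI G} {I : ModuleCat.{w} k}
    (f : V ⟶ coind (OI.shift.obj s) I) :
    ∃ g : deriv V ⟶ coind s I, ∀ x : V.obj (OI.shift.obj s),
      coindEval s I (g.app s ((derivProj V).app s x)) =
        coindEval (OI.shift.obj s) I (f.app (OI.shift.obj s) x) := by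
  have hf := decomposable_le_ker_coindEval_comp f
  obtain ⟨g, hg⟩ := exists_hom_coind (V := deriv V) (s := s)
    ((LinearMap.range ((frontTrans V).app s).hom).liftQ
      (coindEval (OI.shift.obj s) I ∘ₗ (f.app (OI.shift.obj s)).hom) (by
        rintro _ ⟨x, rfl⟩
        exact hf (map_mem_decomposable V (Nat.lt_succ_self s.size) (OI.front s) x))) (by
    intro x hx
    obtain ⟨x, rfl⟩ := derivProj_surjective V s x
    exact hf ((derivProj_mem_decomposable_iff V s x).1 hx))
  exact ⟨g, fun x => hg _⟩

theorem exists_hom_of_deriv {V : OIModule.{u, v, w} k G} {s : OI G} {I : ModuleCat.{w} k}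
    (g : deriv V ⟶ coind s I) :
    ∃ f : V ⟶ coind (OI.shift.obj s) I, ∀ x : V.obj (OI.shift.obj s),
      coindEval (OI.shift.obj s) I (f.app (OI.shift.obj s) x) =
        coindEval s I (g.app s ((derivProj V).app s x)) := by
  have hg := decomposable_le_ker_coindEval_comp g
  exact exists_hom_coind (V := V) (s := OI.shift.obj s) (coindEval s I ∘ₗ (g.app s).hom ∘ₗ ((derivProj V).app s).hom)
    fun x hx => hg ((derivProj_mem_decomposable_iff V s x).2 hx)

/-! ### Vanishing of Ext into coinduced modules -/

variable [Small.{w} k]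

instance : HasExt.{w} (OIModule.{u, v, w} k G) := hasExt_of_enoughProjectives _

open Abelian

/-- The vanishing of `Ext^n(V, coind s I)` for all `I`, a strong form of `H_n(V)_s = 0`. -/
def ExtVanish (V : OIModule.{u, v, w} k G) (s : OI G) (n : ℕ) : Prop :=
  ∀ (I : ModuleCat.{w} k) (e : Ext V (coind s I) n), e = 0

theorem extVanish_zero_iff {V : OIModule.{u, v, w} k G} {s : OI G} :
    ExtVanish V s 0 ↔ ∀ (I : ModuleCat.{w} k) (f : V ⟶ coind s I), f = 0 := by
  refine ⟨fun h I f => (Ext.mk₀_eq_zero_iff f).1 (h I _), fun h I e => ?_⟩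
  rw [← Ext.mk₀_addEquiv₀_apply e, h I (Ext.addEquiv₀ e), Ext.mk₀_zero]

theorem ExtVanish.of_projective (V : OIModule.{u, v, w} k G) [Projective V] (s : OI G) (n : ℕ) :
    ExtVanish V s (n + 1) := fun _ e => Ext.eq_zero_of_projective e

theorem ExtVanish.of_iso {V W : OIModule.{u, v, w} k G} (f : V ≅ W) {s : OI G} {n : ℕ}
    (h : ExtVanish V s n) : ExtVanish W s n := fun I e => by
  have h0 := h I ((Ext.mk₀ f.hom).comp e (zero_add n))
  have h1 : (Ext.mk₀ f.inv).comp ((Ext.mk₀ f.hom).comp e (zero_add n)) (zero_add n) = e := by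
    rw [Ext.mk₀_comp_mk₀_assoc, f.inv_hom_id, Ext.mk₀_id_comp]
  rw [← h1, h0, Ext.comp_zero]

namespace IsShortExact

variable {A B C : OIModule.{u, v, w} k G} {f : A ⟶ B} {g : B ⟶ C} {s : OI G} {n : ℕ}

theorem extVanish_middle (h : IsShortExact f g) (hA : ExtVanish A s n) (hC : ExtVanish C s n) :
    ExtVanish B s n := fun I e => by
  obtain ⟨x, rfl⟩ := Ext.contravariant_sequence_exact₂ h.shortExact _ e (hA I _)
  rw [hC I x, Ext.comp_zero]

theorem extVanish_right (h : IsShortExact f g) (hB : ExtVanish B s (n + 1))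
    (hA : ExtVanish A s n) : ExtVanish C s (n + 1) := fun I e => by
  obtain ⟨x, rfl⟩ := Ext.contravariant_sequence_exact₃ h.shortExact _ e (hB I _) (add_comm 1 n)
  rw [hA I x, Ext.comp_zero]

theorem extVanish_left (h : IsShortExact f g) (hB : ExtVanish B s n)
    (hC : ExtVanish C s (n + 1)) : ExtVanish A s n := fun I e => by
  obtain ⟨x, rfl⟩ := Ext.contravariant_sequence_exact₁ h.shortExact _ e (add_comm 1 n) (hC I _)
  rw [hB I x, Ext.comp_zero]

end IsShortExact

/-- Every module is a quotient of a free module. -/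
theorem exists_freeBasis_surjective (V : OIModule.{u, v, w} k G) :
    ∃ (P : OIModule.{u, v, w} k G) (_ : FreeBasis P) (p : P ⟶ V),
      ∀ s, Function.Surjective (p.app s) := by
  obtain ⟨P, F, hF⟩ := exists_freeBasis (k := k) (G := G) fun r => V.obj ⟨r⟩
  refine ⟨P, F, F.desc fun r b => ((congrFun hF r).mp b).down, fun s x => ?_⟩
  refine ⟨F.basis s ⟨s.size, (congrFun hF s.size).mpr ⟨x⟩, 𝟙 s⟩, ?_⟩
  refine (F.desc_basis _ s s.size _ (𝟙 s)).trans ?_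
  rw [CategoryTheory.Functor.map_id]
  simp

/-- D preserves exactness of a free cover of the front-injective `X` and matches morphisms into
coinduced modules, which settles n ≤ 1; dimension shifting does the rest, since the kernel of the
cover is again front-injective. -/
theorem ExtVanish.of_deriv {s : OI G} : ∀ (n : ℕ) {X : OIModule.{u, v, w} k G},
    FrontInjective X → ExtVanish (deriv X) s n → ExtVanish X (OI.shift.obj s) n
  | 0, X, _, h => by
    rw [extVanish_zero_iff] at h ⊢
    intro I f
    obtain ⟨g, hg⟩ := exists_hom_deriv f
    refine coind_hom_ext fun x => ?_
    rw [← hg x, h I g]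
    exact (map_zero (coindEval s I)).trans (map_zero (coindEval (OI.shift.obj s) I)).symm
  | 1, X, hX, h => fun I e => by
    obtain ⟨P, F, p, hp⟩ := exists_freeBasis_surjective X
    have hS := Sub.isShortExact_ker p hp
    have hD := hS.deriv hX
    have := F.projective
    -- The class `e` is the connecting image of some `f` on the kernel. Transferred to the
    -- derivative, `f` extends to D`P` because Ext¹ of D`X` vanishes; transferring back extends `f`
    -- to `P`, whence `e = 0`.
    obtain ⟨x, rfl⟩ := Ext.contravariant_sequence_exact₃ hS.shortExact _ e
      (ExtVanish.of_projective P _ 0 I _) (add_zero 1)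
    obtain ⟨f, rfl⟩ := (Ext.mk₀_bijective _ _).2 x
    obtain ⟨g, hg⟩ := exists_hom_deriv f
    obtain ⟨y, hy⟩ := Ext.contravariant_sequence_exact₁ hD.shortExact _ (Ext.mk₀ g)
      (add_zero 1) (h I _)
    obtain ⟨g', rfl⟩ := (Ext.mk₀_bijective _ _).2 y
    rw [Ext.mk₀_comp_mk₀] at hy
    replace hy := (Ext.mk₀_bijective _ _).1 hy
    obtain ⟨f', hf'⟩ := exists_hom_of_deriv g'
    have hff : (Sub.ker p).incl ≫ f' = f := by
      refine coind_hom_ext fun x => ?_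
      refine (hf' _).trans ((hg x).symm.trans ?_).symm
      rw [← hy]
      rfl
    rw [← hff, ← Ext.mk₀_comp_mk₀]
    exact hS.shortExact.extClass_comp_assoc _
  | n + 2, X, hX, h => by
    obtain ⟨P, F, p, hp⟩ := exists_freeBasis_surjective X
    have hS := Sub.isShortExact_ker p hp
    have := F.projective
    obtain ⟨F', -⟩ := F.exists_deriv
    have := F'.projective
    refine hS.extVanish_right (ExtVanish.of_projective P _ _) (ExtVanish.of_deriv (n + 1)
      (F.frontInjective.of_injective _ (Sub.incl_injective _)) ?_)
    exact (hS.deriv hX).extVanish_left (ExtVanish.of_projective _ _ _) h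

end OIModule

/-- Chains of monotone sequences in a Noetherian order stabilize. -/
theorem WellFoundedGT.exists_forall_ge_eq_of_monotone₂ {α : Type*} [PartialOrder α]
    [WellFoundedGT α] (f : ℕ → ℕ → α) (hf : ∀ {i i' j j'}, i ≤ i' → j ≤ j' → f i j ≤ f i' j') :
    ∃ N, ∀ i, N ≤ i → ∀ j, f i j = f N j := by
  have hd : ∃ N, ∀ i, N ≤ i → f N N = f i i :=
    WellFoundedGT.monotone_chain_condition ⟨fun i => f i i, fun _ _ h => hf h h⟩
  have hr : ∀ j, ∃ N, ∀ i, N ≤ i → f N j = f i j := fun j =>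
    WellFoundedGT.monotone_chain_condition ⟨fun i => f i j, fun _ _ h => hf h le_rfl⟩
  obtain ⟨N, hN⟩ := hd
  choose M hM using hr
  -- Columns with j ≥ N are squeezed between terms of the stable diagonal; the sum dominates the
  -- stabilization index of each of the finitely many columns j < N.
  refine ⟨N + ∑ j ∈ Finset.range N, M j, fun i hi j => ?_⟩
  rcases lt_or_ge j N with hj | hj
  · have hle : M j ≤ N + ∑ j ∈ Finset.range N, M j :=
      (Finset.single_le_sum (f := M) (fun _ _ => Nat.zero_le _) (Finset.mem_range.2 hj)).trans
        (Nat.le_add_left _ _)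
    rw [← hM j i (hle.trans hi), ← hM j _ hle]
  · have key : ∀ i, N ≤ i → f i j = f N N := fun i hi => le_antisymm
      ((hf (le_max_left i j) (le_max_right i j)).trans
        (hN (max i j) (hi.trans (le_max_left _ _))).ge) (hf hi hj)
    rw [key i ((Nat.le_add_right _ _).trans hi), key _ (Nat.le_add_right _ _)]

/-! ### Noetherianity of finitely generated free modules -/

namespace OIModule

variable {k : Type u} [CommRing k] {G : Type v} [Group G]

namespace Sub

variable {P : OIModule.{u, v, w} k G}

/-- The elements which are mapped into `X` by the map to the shift. -/
def frontPreimage (X : Sub P) : Sub P where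
  val s := (X.val (OI.shift.obj s)).comap (P.map (OI.front s)).hom
  map_mem {r s} a x hx := by
    have := X.map_mem (OI.shift.map a) _ hx
    have e : P.map (OI.front s) (P.map a x) = P.map (OI.shift.map a) (P.map (OI.front r) x) :=
      app_map (frontTrans P) a x
    exact Submodule.mem_comap.2 (e ▸ this)

theorem mem_frontPreimage {X : Sub P} {s : OI G} {x : P.obj s} :
    x ∈ X.frontPreimage.val s ↔ P.map (OI.front s) x ∈ X.val (OI.shift.obj s) := Iff.rfl

theorem le_frontPreimage (X : Sub P) : X ≤ X.frontPreimage := fun s x hx =>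
  X.map_mem (OI.front s) x hx

theorem frontPreimage_mono : Monotone (frontPreimage (P := P)) := fun _ _ h s _ hx =>
  h (OI.shift.obj s) hx

/-- The image in the derivative of the shift of a submodule. -/
def derivImage (X : Sub P) : Sub (deriv P) where
  val s := (X.val (OI.shift.obj s)).map ((derivProj P).app s).hom
  map_mem {r s} a := by
    rintro _ ⟨x, hx, rfl⟩
    exact ⟨P.map (OI.shift.map a) x, X.map_mem _ _ hx, rfl⟩

theorem mem_derivImage {X : Sub P} {s : OI G} {y : (deriv P).obj s} :
    y ∈ X.derivImage.val s ↔ ∃ x ∈ X.val (OI.shift.obj s), (derivProj P).app s x = y := Iff.rfl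

theorem derivImage_mono : Monotone (derivImage (P := P)) := fun _ _ h s =>
  Submodule.map_mono (h (OI.shift.obj s))

/-- Elements with the same image in the derivative differ by the front image of an element one
degree lower, lying in the next iterated preimage. Hence the induction on the degree must treat all
iterates j at once. -/
theorem le_of_derivImage_le {X Z : Sub P} (hXZ : X ≤ Z)
    (h : ∀ j, (frontPreimage^[j] Z).derivImage ≤ (frontPreimage^[j] X).derivImage)
    (h₀ : ∀ j, (frontPreimage^[j] Z).val ⟨0⟩ ≤ (frontPreimage^[j] X).val ⟨0⟩) : Z ≤ X := by
  suffices H : ∀ n j, (frontPreimage^[j] Z).val ⟨n⟩ ≤ (frontPreimage^[j] X).val ⟨n⟩ from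
    fun s => H s.size 0
  intro n
  induction n with
  | zero => exact h₀
  | succ n ih =>
    intro j (z : P.obj (OI.shift.obj ⟨n⟩)) hz
    obtain ⟨x, hx, hxz⟩ := mem_derivImage.1 (h j ⟨n⟩ (mem_derivImage.2 ⟨z, hz, rfl⟩))
    have hle : frontPreimage^[j] X ≤ frontPreimage^[j] Z := frontPreimage_mono.iterate j hXZ
    have h0 : (derivProj P).app ⟨n⟩ (z - x) = 0 :=
      (map_sub ((derivProj P).app ⟨n⟩).hom z x).trans (sub_eq_zero.2 hxz.symm)
    obtain ⟨p, hp⟩ := (derivProj_eq_zero_iff P ⟨n⟩ _).1 h0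
    have hpZ : p ∈ (frontPreimage^[j + 1] Z).val ⟨n⟩ := by
      rw [Function.iterate_succ_apply', mem_frontPreimage]
      exact hp ▸ Submodule.sub_mem _ hz (hle ⟨n + 1⟩ hx)
    have hpX := ih (j + 1) hpZ
    rw [Function.iterate_succ_apply', mem_frontPreimage, hp] at hpX
    exact (Submodule.sub_mem_iff_left _ hx).1 hpX

theorem iterate_frontPreimage_le_of_le (X : Sub P) {i j : ℕ} (h : i ≤ j) :
    frontPreimage^[i] X ≤ frontPreimage^[j] X := by
  induction h with
  | refl => exact le_rfl
  | step _ ih =>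
    rw [Function.iterate_succ_apply']
    exact ih.trans (le_frontPreimage _)

/-- For a chain X_i, the derivative images and the degree-0 parts of the j-th preimages of X_i are
monotone in both indices, so they stabilize at an index i independent of j. -/
theorem wellFoundedGT_of_deriv [WellFoundedGT (Sub (deriv P))]
    [WellFoundedGT (Submodule k (P.obj ⟨0⟩))] : WellFoundedGT (Sub P) := by
  rw [wellFoundedGT_iff_monotone_chain_condition]
  intro X
  have hX : ∀ {i i' j j' : ℕ}, i ≤ i' → j ≤ j' →
      frontPreimage^[j] (X i) ≤ frontPreimage^[j'] (X i') := fun hi hj =>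
    (frontPreimage_mono.iterate _ (X.monotone hi)).trans (iterate_frontPreimage_le_of_le _ hj)
  obtain ⟨N, hN⟩ := WellFoundedGT.exists_forall_ge_eq_of_monotone₂
    (fun i j => (frontPreimage^[j] (X i)).derivImage)
    fun hi hj => derivImage_mono (hX hi hj)
  obtain ⟨M, hM⟩ := WellFoundedGT.exists_forall_ge_eq_of_monotone₂
    (fun i j => (frontPreimage^[j] (X i)).val ⟨0⟩) fun hi hj => hX hi hj ⟨0⟩
  refine ⟨max N M, fun i hi => le_antisymm (X.monotone hi) ?_⟩
  refine le_of_derivImage_le (X.monotone hi) (fun j => ?_) fun j => ?_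
  · exact ((hN i ((le_max_left _ _).trans hi) j).trans (hN _ (le_max_left _ _) j).symm).le
  · exact ((hM i ((le_max_right _ _).trans hi) j).trans (hM _ (le_max_right _ _) j).symm).le

theorem isShortExact_frontPreimage (hP : FrontInjective P) (X : Sub P) :
    ∃ (f : X.frontPreimage.toModule ⟶ OI.shift ⋙ X.toModule)
      (g : OI.shift ⋙ X.toModule ⟶ X.derivImage.toModule), IsShortExact f g := by
  refine ⟨homMk (fun s => (P.map (OI.front s)).hom.restrict fun _ hx => hx) fun {r s} a x =>
      X.incl_injective _ (app_map (frontTrans P) a (X.frontPreimage.incl.app r x)),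
    X.derivImage.lift (Functor.whiskerLeft OI.shift X.incl ≫ derivProj P)
      fun s x => ⟨X.incl.app _ x, X.incl_app_mem _ x, rfl⟩, ?_⟩
  refine ⟨fun s x y hxy => Subtype.ext (hP s (congrArg (X.incl.app (OI.shift.obj s)) hxy)),
    ?_, fun s x => ⟨fun hx => ?_, ?_⟩⟩
  · rintro s ⟨_, x, hx, rfl⟩
    exact ⟨⟨x, hx⟩, rfl⟩
  · obtain ⟨y, hy⟩ := (derivProj_eq_zero_iff P s _).1 (congrArg (X.derivImage.incl.app s) hx)
    refine ⟨⟨y, mem_frontPreimage.2 (hy ▸ X.incl_app_mem _ x)⟩, Subtype.ext hy⟩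
  · rintro ⟨y, rfl⟩
    exact Subtype.ext ((derivProj_eq_zero_iff P s _).2 ⟨X.frontPreimage.incl.app s y, rfl⟩)

/-- If `X` is saturated, then its derivative embeds into that of the ambient module. -/
theorem nonempty_iso_derivImage {X : Sub P} (hX : X.frontPreimage = X) :
    Nonempty (X.derivImage.toModule ≅ deriv X.toModule) := by
  let h : deriv X.toModule ⟶ X.derivImage.toModule := X.derivImage.lift (derivMap X.incl)
    fun s y => by
      obtain ⟨x, rfl⟩ := derivProj_surjective X.toModule s y
      exact ⟨X.incl.app _ x, X.incl_app_mem _ x, rfl⟩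
  have : IsIso h := by
    refine isIso_of_bijective h fun s => ⟨?_, ?_⟩
    · refine (injective_iff_map_eq_zero (h.app s).hom).2 fun y hy => ?_
      obtain ⟨x, rfl⟩ := derivProj_surjective X.toModule s y
      obtain ⟨p, hp⟩ := (derivProj_eq_zero_iff P s _).1 (congrArg (X.derivImage.incl.app s) hy)
      have hpX : p ∈ X.val s := by
        rw [← hX, mem_frontPreimage, hp]
        exact X.incl_app_mem _ x
      exact (derivProj_eq_zero_iff X.toModule s x).2 ⟨⟨p, hpX⟩, X.incl_injective _ hp⟩
    · rintro ⟨_, x, hx, rfl⟩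
      exact ⟨(derivProj X.toModule).app s ⟨x, hx⟩, rfl⟩
  exact ⟨(asIso h).symm⟩

end Sub

/-! ### Induction on the degrees of the generators -/

namespace FreeBasis

variable {P : OIModule.{u, v, w} k G} (F : FreeBasis P)

/-- The free module has finitely many generators, all of degree less than `n`. -/
structure IsFiniteBelow (n : ℕ) : Prop where
  finite : ∀ r, Finite (F.B r)
  isEmpty : ∀ r, n ≤ r → IsEmpty (F.B r)

variable {F}

theorem IsFiniteBelow.finite_index [Finite G] {n : ℕ} (h : F.IsFiniteBelow n) (s : OI G) :
    Finite (Σ r : ℕ, F.B r × ((⟨r⟩ : OI G) ⟶ s)) := by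
  have hlt : ∀ r, F.B r → r < n := fun r b => not_le.1 fun hr => (h.isEmpty r hr).false b
  have := h.finite
  refine Finite.of_injective (β := Σ r : Fin n, F.B r × ((⟨r⟩ : OI G) ⟶ s))
    (fun i => ⟨⟨i.1, hlt i.1 i.2.1⟩, i.2⟩) ?_
  rintro ⟨r, x⟩ ⟨r', x'⟩ hx
  simp only [Sigma.mk.injEq, Fin.mk.injEq] at hx
  obtain ⟨rfl, hx⟩ := hx
  rw [eq_of_heq hx]

theorem IsFiniteBelow.subsingleton (h : F.IsFiniteBelow 0) (s : OI G) :
    Subsingleton (P.obj s) := by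
  have : IsEmpty (Σ r : ℕ, F.B r × ((⟨r⟩ : OI G) ⟶ s)) :=
    ⟨fun i => (h.isEmpty i.1 (Nat.zero_le _)).false i.2.1⟩
  exact (F.basis s).repr.toEquiv.subsingleton

theorem IsFiniteBelow.exists_deriv [Finite G] {n : ℕ} (h : F.IsFiniteBelow (n + 1)) :
    ∃ F' : FreeBasis (deriv P), F'.IsFiniteBelow n := by
  obtain ⟨F', hF'⟩ := F.exists_deriv
  have := h.finite
  refine ⟨F', fun r => ?_, fun r hr => ?_⟩
  · rw [hF']
    infer_instance
  · rw [hF']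
    have := h.isEmpty (r + 1) (Nat.succ_le_succ hr)
    infer_instance

theorem IsFiniteBelow.wellFoundedGT [Finite G] [IsNoetherianRing k] : ∀ (n : ℕ)
    {P : OIModule.{u, v, w} k G} {F : FreeBasis P}, F.IsFiniteBelow n → WellFoundedGT (Sub P)
  | 0, P, F, h => by
    have := h.subsingleton
    have : Subsingleton (Sub P) := ⟨fun M N => Sub.ext fun s => Subsingleton.elim _ _⟩
    exact Finite.to_wellFoundedGT
  | n + 1, P, F, h => by
    obtain ⟨F', hF'⟩ := h.exists_deriv
    have := wellFoundedGT n hF'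
    have := h.finite_index ⟨0⟩
    have : Module.Finite k (P.obj ⟨0⟩) := Module.Finite.of_basis (F.basis ⟨0⟩)
    have : WellFoundedGT (Submodule k (P.obj ⟨0⟩)) :=
      isNoetherian_iff'.1 (isNoetherian_of_isNoetherianRing_of_finite k _)
    exact Sub.wellFoundedGT_of_deriv

end FreeBasis

/-! ### Bounds for submodules of free modules and for finitely generated modules -/

variable [Finite G] [Small.{w} k]

/-- A bound for the regularity in terms of `Ext`. -/
def ExtBounded (V : OIModule.{u, v, w} k G) (c : ℕ) : Prop :=
  ∀ (i : ℕ) (s : OI G), c + i < s.size → ExtVanish V s i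

theorem ExtVanish.of_subsingleton {V : OIModule.{u, v, w} k G} (h : ∀ s, Subsingleton (V.obj s))
    (s : OI G) (n : ℕ) : ExtVanish V s n := by
  have hz : 𝟙 V = 0 := hom_ext_apply fun s x => Subsingleton.elim _ _
  intro I e
  rw [← Abelian.Ext.mk₀_id_comp e, hz, Abelian.Ext.mk₀_zero, Abelian.Ext.zero_comp]

theorem GeneratedInDegreesLE.extVanish_zero {V : OIModule.{u, v, w} k G} {n : ℕ}
    (h : GeneratedInDegreesLE V n) {s : OI G} (hs : n < s.size) : ExtVanish V s 0 :=
  extVanish_zero_iff.2 fun _ f => eq_zero_of_decomposable_eq_top (h s hs) f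

/-- The outer terms bound the shift of `X`; the sequence from `X` to its shift and its derivative
then trades homological degree i + 1 in degree s + 1 for i in degree s. -/
theorem Sub.exists_extBounded_of_frontPreimage {P : OIModule.{u, v, w} k G}
    (hP : FrontInjective P) {X : Sub P} {n c₁ c₂ : ℕ}
    (hX : GeneratedInDegreesLE X.toModule n)
    (h₁ : ExtBounded X.frontPreimage.toModule c₁) (h₂ : ExtBounded X.derivImage.toModule c₂) :
    ∃ c, ExtBounded X.toModule c := by
  -- The summand `n` covers i = 0. The two extra units compensate for using `h₁` and `h₂` at i + 1
  -- in degree s rather than s + 1.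
  refine ⟨n + (c₁ + 1) + (c₂ + 1), fun i => ?_⟩
  obtain ⟨f, g, hfg⟩ := X.isShortExact_frontPreimage hP
  have hX' : FrontInjective X.toModule := hP.of_injective _ X.incl_injective
  induction i with
  | zero => exact fun s hs => hX.extVanish_zero (by omega)
  | succ i ih =>
    rintro ⟨_ | s⟩ hs
    · exact absurd hs (Nat.not_lt_zero _)
    · have hs' : n + (c₁ + 1) + (c₂ + 1) + (i + 1) < s + 1 := hs
      refine ExtVanish.of_deriv (s := ⟨s⟩) (i + 1) hX' ?_
      refine hX'.isShortExact.extVanish_right ?_ (ih ⟨s⟩ (show _ < s by omega))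
      exact hfg.extVanish_middle (h₁ _ ⟨s⟩ (show _ < s by omega))
        (h₂ _ ⟨s⟩ (show _ < s by omega))

theorem FreeBasis.IsFiniteBelow.exists_extBounded [IsNoetherianRing k] : ∀ (n : ℕ)
    {P : OIModule.{u, v, w} k G} {F : FreeBasis P}, F.IsFiniteBelow n →
    ∀ X : Sub P, ∃ c, ExtBounded X.toModule c
  | 0, P, F, h, X => by
    have := h.subsingleton
    refine ⟨0, fun i s _ => ExtVanish.of_subsingleton (fun s => ?_) s i⟩
    exact (X.incl_injective s).subsingleton
  | n + 1, P, F, h, X => by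
    obtain ⟨F', hF'⟩ := h.exists_deriv
    have := h.wellFoundedGT
    induction X using WellFoundedGT.induction with
    | ind X ih =>
      obtain ⟨c₂, h₂⟩ := exists_extBounded n hF' X.derivImage
      -- A saturated `X` has derivative isomorphic to its image in that of `P`, which costs one
      -- degree; otherwise the Noetherian induction applies to the strictly larger preimage.
      rcases X.le_frontPreimage.eq_or_lt with hX | hX
      · obtain ⟨e⟩ := Sub.nonempty_iso_derivImage hX.symm
        refine ⟨c₂ + 1, ?_⟩
        rintro i ⟨_ | s⟩ hs
        · exact absurd hs (Nat.not_lt_zero _)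
        · have hs' : c₂ + 1 + i < s + 1 := hs
          exact ExtVanish.of_deriv (s := ⟨s⟩) i
            (F.frontInjective.of_injective _ X.incl_injective)
            ((h₂ i ⟨s⟩ (show _ < s by omega)).of_iso e)
      · obtain ⟨c₁, h₁⟩ := ih _ hX
        obtain ⟨m, hm⟩ := exists_generatedInDegreesLE_toModule X
        exact Sub.exists_extBounded_of_frontPreimage F.frontInjective hm h₁ h₂

/-- Every finitely generated module is a quotient of a finitely generated free module. -/
theorem IsFinitelyGenerated.exists_freeBasis {V : OIModule.{u, v, w} k G}
    (hV : V.IsFinitelyGenerated) :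
    ∃ (P : OIModule.{u, v, w} k G) (F : FreeBasis P) (n : ℕ) (p : P ⟶ V),
      F.IsFiniteBelow n ∧ ∀ s, Function.Surjective (p.app s) := by
  obtain ⟨T, hT, h⟩ := hV
  obtain ⟨n, hn⟩ := (hT.image fun x => x.1.size).bddAbove
  obtain ⟨P, F, hF⟩ := OIModule.exists_freeBasis (k := k) (G := G)
    fun r => {x : V.obj ⟨r⟩ // (⟨⟨r⟩, x⟩ : Σ s : OI G, V.obj s) ∈ T}
  let p : P ⟶ V := F.desc fun r b => ((congrFun hF r).mp b).down
  refine ⟨P, F, n + 1, p, ⟨fun r => ?_, fun r hr => ?_⟩, fun s => ?_⟩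
  · rw [hF]
    have := hT.to_subtype
    have : Finite {x : V.obj ⟨r⟩ // (⟨⟨r⟩, x⟩ : Σ s : OI G, V.obj s) ∈ T} :=
      Finite.of_injective (β := T) (fun x => ⟨⟨⟨r⟩, x.1⟩, x.2⟩) fun x y hxy => by
        simp only [Subtype.mk.injEq, Sigma.mk.injEq, heq_eq_eq, true_and] at hxy
        exact Subtype.ext hxy
    infer_instance
  · rw [hF]
    refine ⟨fun b => ?_⟩
    have : r ≤ n := hn ⟨_, b.down.2, rfl⟩
    omega
  · let R : Sub V :=
      { val := fun s => LinearMap.range (p.app s).hom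
        map_mem := by
          rintro r s a _ ⟨x, rfl⟩
          exact ⟨P.map a x, app_map p a x⟩ }
    refine LinearMap.range_eq_top.1 (h R ?_ s)
    rintro ⟨⟨r⟩, x⟩ hx
    refine ⟨F.basis ⟨r⟩ ⟨r, (congrFun hF r).mpr ⟨⟨x, hx⟩⟩, 𝟙 _⟩, ?_⟩
    refine (F.desc_basis _ ⟨r⟩ r _ (𝟙 _)).trans ?_
    rw [CategoryTheory.Functor.map_id]
    simp

theorem IsFinitelyGenerated.exists_extBounded [IsNoetherianRing k]
    {V : OIModule.{u, v, w} k G} (hV : V.IsFinitelyGenerated) : ∃ c, ExtBounded V c := by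
  obtain ⟨m, hm⟩ := hV.exists_generatedInDegreesLE
  obtain ⟨P, F, n, p, hF, hp⟩ := hV.exists_freeBasis
  obtain ⟨c, hc⟩ := hF.exists_extBounded n (Sub.ker p)
  have := F.projective
  refine ⟨m + c, fun i s hs => ?_⟩
  cases i with
  | zero => exact hm.extVanish_zero (by omega)
  | succ i =>
    exact (Sub.isShortExact_ker p hp).extVanish_right (.of_projective P s i)
      (hc i s (by omega))

end OIModule

/-! ### From Ext vanishing to homology and regularity -/

namespace OIModule

variable {k : Type u} [CommRing k] {G : Type v} [Group G] [Finite G]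

/-- A morphism to a coinduced module which detects the image of `H₀(Q)_s` in `H₀(P)_s`. -/
theorem exists_hom_coind_quotient {Q P : OIModule.{u, v, w} k G} (d : Q ⟶ P) (s : OI G) :
    ∃ (I : ModuleCat.{w} k) (f : P ⟶ coind s I), d ≫ f = 0 ∧
      ∀ x : P.obj s, coindEval s I (f.app s x) = 0 →
        ∃ y : ((H₀ k G).obj Q).obj s,
          ((H₀ k G).map d).app s y = (Submodule.mkQ (decomposable P s)) x := by
  let M : Submodule k (P.obj s ⧸ decomposable P s) :=
    LinearMap.range (((H₀ k G).map d).app s).hom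
  obtain ⟨f, hf⟩ := exists_hom_coind (V := P) (s := s)
    (I := ModuleCat.of k ((P.obj s ⧸ decomposable P s) ⧸ M))
    (M.mkQ ∘ₗ (decomposable P s).mkQ) (by
      intro x hx
      have : (decomposable P s).mkQ x = 0 := (Submodule.Quotient.mk_eq_zero _).2 hx
      rw [LinearMap.mem_ker, LinearMap.comp_apply, this, map_zero])
  refine ⟨_, f, coind_hom_ext fun x => ?_, fun x hx => ?_⟩
  · refine (hf (d.app s x)).trans ?_
    refine Eq.trans ?_ (map_zero (coindEval s _)).symm
    exact (Submodule.Quotient.mk_eq_zero M).2 ⟨(decomposable Q s).mkQ x, rfl⟩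
  · rw [hf] at hx
    exact (Submodule.Quotient.mk_eq_zero M).1 hx

variable [Small.{w} k]

/-- The vanishing of `Ext` into the coinduced modules implies the vanishing of homology. -/
theorem ExtVanish.subsingleton_homology {V : OIModule.{u, v, w} k G} {s : OI G} {i : ℕ}
    (h : ExtVanish V s i) : Subsingleton ((homology V i).obj s) := by
  let R := projectiveResolution V
  let K := ((H₀.{u, v, w} k G).mapHomologicalComplex (ComplexShape.down ℕ)).obj R.complex
  let E := (evaluation (OI G) (ModuleCat.{w} k)).obj s
  have key : ∀ m, i + 1 = m → ((K.sc' m i ((ComplexShape.down ℕ).next i)).map E).Exact := by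
    rintro m hm
    refine (ShortComplex.moduleCat_exact_iff _).2 fun x hx => ?_
    obtain ⟨x, rfl⟩ := Submodule.mkQ_surjective (decomposable (R.complex.X i) s) x
    -- `I` is the cokernel of the incoming differential on H_0 in degree `s`, so a cycle is a
    -- boundary as soon as `f` kills it. As `f` vanishes on the incoming differential, it is a
    -- cocycle and represents a class in Ext^i.
    obtain ⟨I, f, hdf, hf⟩ := exists_hom_coind_quotient (R.complex.d m i) s
    refine hf x ?_
    have hx' : (R.complex.d i ((ComplexShape.down ℕ).next i)).app s x ∈
        decomposable (R.complex.X ((ComplexShape.down ℕ).next i)) s :=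
      (Submodule.Quotient.mk_eq_zero _).1 hx
    cases i with
    | zero =>
      have hf0 : f = 0 := by
        subst hm
        obtain ⟨l, hl⟩ := CokernelCofork.IsColimit.desc' R.isColimitCokernelCofork f hdf
        rw [← hl]
        exact (congrArg _ (extVanish_zero_iff.1 h I l)).trans comp_zero
      rw [hf0]
      exact map_zero (coindEval s I)
    | succ i =>
      -- The class of `f` vanishes, so `f` is the differential followed by `g`; the differential of
      -- `x` is decomposable, hence killed.
      obtain ⟨g, hg⟩ := (R.extMk_eq_zero_iff f m hm hdf i rfl).1 (h I _)
      have hn : (ComplexShape.down ℕ).next (i + 1) = i := ChainComplex.next_nat_succ i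
      rw [hn] at hx'
      rw [← hg]
      exact decomposable_le_ker_coindEval_comp g hx'
  have hp : (ComplexShape.down ℕ).prev i = i + 1 := ChainComplex.prev ℕ i
  have hK : ((K.sc i).map E).Exact := key _ hp.symm
  have e : (homology V i).obj s ≅ ((K.sc i).map E).homology :=
    E.mapIso (R.isoLeftDerivedObj (H₀ k G) i) ≪≫ ((K.sc i).mapHomologyIso E).symm
  have hz := ((ShortComplex.exact_iff_isZero_homology _).1 hK).of_iso e
  exact ModuleCat.subsingleton_of_isZero hz

theorem ExtBounded.reg_lt_top {V : OIModule.{u, v, w} k G} {c : ℕ} (h : ExtBounded V c) :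
    V.reg < ⊤ := by
  have hhd : ∀ i, hd V i ≤ (((c + i : ℕ) : ℝ) : EReal) := fun i => by
    refine max_le ?_ (iSup₂_le fun s hs => ?_)
    · have : (-1 : EReal) = ((-1 : ℝ) : EReal) := by simp
      rw [this, EReal.coe_le_coe_iff]
      linarith [(Nat.cast_nonneg (c + i) : (0 : ℝ) ≤ _)]
    · rw [EReal.coe_le_coe_iff, Nat.cast_le]
      by_contra! hlt
      exact not_subsingleton_iff_nontrivial.2 hs (h i ⟨s⟩ hlt).subsingleton_homology
  refine lt_of_le_of_lt (b := ((c : ℝ) : EReal)) (iSup_le fun i => ?_) (EReal.coe_lt_top _)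
  refine (EReal.sub_le_sub (hhd i) le_rfl).trans ?_
  rw [← EReal.coe_sub, EReal.coe_le_coe_iff]
  push_cast
  linarith

end OIModule

theorem mainTheorem6 {k : Type u} [CommRing k] [IsNoetherianRing k] [Small.{w} k]
    {G : Type v} [Group G] [Finite G]
    (V : OIModule.{u, v, w} k G) (hV : V.IsFinitelyGenerated) :
    V.reg < ⊤ := by
  obtain ⟨c, hc⟩ := hV.exists_extBounded
  exact hc.reg_lt_top
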